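/- Let $m\in\mathbb N$, $a,x_0\in\mathbb{R}^m$, $b,c\in\mathbb{R}$, $R>0$, $T\ge 0$, let $\|\cdot\|$ be the Euclidean norm, and let $\mathbb{B}=\{x\in\mathbb{R}^m:\|x-x_0\|\le R\}$. Assume that $\|a\|\le b-cr$ for all $r\in[0,R]$ (for $c\ge 0$ this is the condition $\|a\|\le b-cR$). Consider the control systems $$\dot x(t)=a+\bigl(b-c\|x(t)-x(0)\|\bigr)u(t),\quad x(0)=x_0,\qquad\qquad \dot z(t)=\bigl(b-c\|z(t)-z(0)\|-\|a\|\bigr)u(t),\quad z(0)=x_0,$$ both defined on $\mathbb{B}$, where the inputs $u$ are measurable with $\|u(t)\|\le 1$. Let $\mathcal{R}_x(T,x_0)$ and $\mathcal{R}_z(T,x_0)$ be their reachable sets at time $T$: the sets of endpoints $x(T)$, respectively $z(T)$, of trajectories (absolutely continuous solutions for some input $u$) which lie in $\mathbb{B}$ on $[0,T]$. Then $$\mathcal{R}_z(T,x_0)\subseteq\mathcal{R}_x(T,x_0),$$ and $\mathcal{R}_z(T,x_0)$ is a closed ball in $\mathbb{B}$ centred at $x_0$: there is $\rho\in[0,R]$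 with $\mathcal{R}_z(T,x_0)=\{y\in\mathbb{R}^m:\|y-x_0\|\le\rho\}$. -/

import Mathlib

open MeasureTheory

/-- An admissible input on `[0, T]`: a measurable signal with values in the closed unit ball. -/
structure IsAdmissibleInput {m : ℕ} (T : ℝ) (u : ℝ → EuclideanSpace ℝ (Fin m)) : Prop where
  measurable : Measurable u
  norm_le_one : ∀ t ∈ Set.Icc 0 T, ‖u t‖ ≤ 1

/-- `x` is a (Carathéodory) trajectory on `[0, T]` of the control system `x' = F(x, u)`, defined on
the domain `D`, with initial state `x₀` and input `u`: a continuous curve in `D` which satisfies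
the integral form of the equation. -/
structure IsTrajectory {m : ℕ}
    (F : EuclideanSpace ℝ (Fin m) → EuclideanSpace ℝ (Fin m) → EuclideanSpace ℝ (Fin m))
    (D : Set (EuclideanSpace ℝ (Fin m))) (T : ℝ) (x₀ : EuclideanSpace ℝ (Fin m))
    (u x : ℝ → EuclideanSpace ℝ (Fin m)) : Prop where
  continuousOn : ContinuousOn x (Set.Icc 0 T)
  mem_domain : ∀ t ∈ Set.Icc 0 T, x t ∈ D
  intervalIntegrable : IntervalIntegrable (fun s => F (x s) (u s)) volume 0 T
  eq_integral : ∀ t ∈ Set.Icc 0 T, x t = x₀ + ∫ s in (0 : ℝ)..t, F (x s) (u s)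

/-- The reachable set at time `T` from `x₀` of the system `x' = F(x, u)` on the domain `D`,
with inputs in the closed unit ball. -/
def reachableSet {m : ℕ}
    (F : EuclideanSpace ℝ (Fin m) → EuclideanSpace ℝ (Fin m) → EuclideanSpace ℝ (Fin m))
    (D : Set (EuclideanSpace ℝ (Fin m))) (T : ℝ) (x₀ : EuclideanSpace ℝ (Fin m)) :
    Set (EuclideanSpace ℝ (Fin m)) :=
  {y | ∃ u x : ℝ → EuclideanSpace ℝ (Fin m),
    IsAdmissibleInput T u ∧ IsTrajectory F D T x₀ u x ∧ x T = y}

/-- Right-hand side of `x' = a + (b - c ‖x - x₀‖) u`. -/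
noncomputable def driftField {m : ℕ} (a : EuclideanSpace ℝ (Fin m)) (b c : ℝ)
    (x₀ x u : EuclideanSpace ℝ (Fin m)) : EuclideanSpace ℝ (Fin m) :=
  a + (b - c * ‖x - x₀‖) • u

/-- Right-hand side of `z' = (b - c ‖z - x₀‖ - ‖a‖) u`. -/
noncomputable def driftlessField {m : ℕ} (a : EuclideanSpace ℝ (Fin m)) (b c : ℝ)
    (x₀ z u : EuclideanSpace ℝ (Fin m)) : EuclideanSpace ℝ (Fin m) :=
  (b - c * ‖z - x₀‖ - ‖a‖) • u

/-! Write β = b - c‖z - x₀‖ ≥ ‖a‖. Spending ‖a‖ of the control authority β on cancelling the drift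
leaves β - ‖a‖ free, so each driftless trajectory also solves the system with drift. For the ball,
let B solve r' = b - ‖a‖ - c r, r(0) = 0. Driftless speed at distance r is at most b - ‖a‖ - c r, so
Grönwall comparison bounds the distance at time T by B(T). Conversely, the radial motion at a
constant fraction k of full speed has distance B(kt); by continuity B(kT) takes every value in [0,
B(T)], and monotonicity of B keeps the path in the ball whenever its endpoint is there. -/

section GronwallProfile

variable {d : ℝ}

theorem continuous_gronwallBound (δ K ε : ℝ) : Continuous (gronwallBound δ K ε) :=
  continuous_iff_continuousAt.2 fun x => (hasDerivAt_gronwallBound δ K ε x).continuousAt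

/-- The derivative is `d * exp (K * x)`, nonnegative whatever the sign of `K`. -/
theorem monotone_gronwallBound_zero (hd : 0 ≤ d) (K : ℝ) : Monotone (gronwallBound 0 K d) := by
  refine monotone_of_deriv_nonneg
    (fun x => (hasDerivAt_gronwallBound 0 K d x).differentiableAt) fun x => ?_
  rw [(hasDerivAt_gronwallBound 0 K d x).deriv]
  by_cases hK : K = 0
  · simpa [hK] using hd
  · rw [gronwallBound_of_K_ne_0 hK]
    have h : K * (0 * Real.exp (K * x) + d / K * (Real.exp (K * x) - 1)) + d
        = d * Real.exp (K * x) := by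
      field_simp
      ring
    rw [h]
    positivity

theorem gronwallBound_zero_nonneg (hd : 0 ≤ d) (K : ℝ) {t : ℝ} (ht : 0 ≤ t) :
    0 ≤ gronwallBound 0 K d t := by
  simpa [gronwallBound_x0] using monotone_gronwallBound_zero hd K ht

end GronwallProfile

section Trajectories

variable {m : ℕ} {F : EuclideanSpace ℝ (Fin m) → EuclideanSpace ℝ (Fin m) →
  EuclideanSpace ℝ (Fin m)} {D : Set (EuclideanSpace ℝ (Fin m))} {T : ℝ}
  {x₀ : EuclideanSpace ℝ (Fin m)} {u x : ℝ → EuclideanSpace ℝ (Fin m)}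

theorem IsTrajectory.sub_eq_integral (h : IsTrajectory F D T x₀ u x) {s t : ℝ}
    (hs : s ∈ Set.Icc 0 T) (ht : t ∈ Set.Icc 0 T) :
    x t - x s = ∫ r in s..t, F (x r) (u r) := by
  have key : ∀ r ∈ Set.Icc 0 T,
      IntervalIntegrable (fun r => F (x r) (u r)) volume 0 r := fun r hr =>
    h.intervalIntegrable.mono_set (by
      rw [Set.uIcc_of_le hr.1, Set.uIcc_of_le (hr.1.trans hr.2)]
      exact Set.Icc_subset_Icc le_rfl hr.2)
  rw [h.eq_integral t ht, h.eq_integral s hs, add_sub_add_left_eq_sub]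
  exact intervalIntegral.integral_interval_sub_left (key t ht) (key s hs)

/-- Along a trajectory whose speed is at most `d + K ‖x - x₀‖`, the distance to the initial state
is at most the solution of `r' = d + K r`, `r 0 = 0`. -/
theorem IsTrajectory.norm_sub_le_gronwallBound (h : IsTrajectory F D T x₀ u x) {d K : ℝ}
    (hF : ∀ t ∈ Set.Icc 0 T, ‖F (x t) (u t)‖ ≤ K * ‖x t - x₀‖ + d) {t : ℝ}
    (ht : t ∈ Set.Icc 0 T) : ‖x t - x₀‖ ≤ gronwallBound 0 K d t := by
  have h0 : x 0 = x₀ := by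
    simpa using h.eq_integral 0 ⟨le_rfl, ht.1.trans ht.2⟩
  have hcont : ContinuousOn (fun t => ‖x t - x₀‖) (Set.Icc 0 T) :=
    (h.continuousOn.sub continuousOn_const).norm
  -- `x` need not be differentiable everywhere, so the comparison uses right difference quotients.
  have key := le_gronwallBound_of_liminf_deriv_right_le (f := fun t => ‖x t - x₀‖)
    (f' := fun t => K * ‖x t - x₀‖ + d) (δ := 0) (K := K) (ε := d) (a := 0) (b := T) hcont ?_
    (by simp [h0]) (fun _ _ => le_rfl) t ht
  · simpa using key
  intro s hs r hr
  have hs' : s ∈ Set.Icc 0 T := Set.Ico_subset_Icc_self hs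
  -- By continuity the speed stays below `q` just after `s`, so the difference quotients there are
  -- at most `q < r`.
  obtain ⟨q, hq, hqr⟩ := exists_between hr
  have hev : ∀ᶠ τ in nhdsWithin s (Set.Icc 0 T), K * ‖x τ - x₀‖ + d < q :=
    ((continuousOn_const.mul hcont).add continuousOn_const s hs').eventually_lt_const hq
  obtain ⟨δ, hδ, hball⟩ := Metric.mem_nhdsWithin_iff.1 hev
  have hlt : s < min (s + δ) T := lt_min (by linarith) hs.2
  refine Filter.Eventually.frequently ?_
  filter_upwards [Ioo_mem_nhdsGT hlt] with τ hτ
  have hτ1 : τ < s + δ := hτ.2.trans_le (min_le_left _ _)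
  have hτ2 : τ < T := hτ.2.trans_le (min_le_right _ _)
  have hτ' : τ ∈ Set.Icc 0 T := ⟨hs.1.trans hτ.1.le, hτ2.le⟩
  have hint : ‖x τ - x s‖ ≤ q * |τ - s| := by
    rw [h.sub_eq_integral hs' hτ']
    refine intervalIntegral.norm_integral_le_of_norm_le_const fun σ hσ => ?_
    rw [Set.uIoc_of_le hτ.1.le] at hσ
    have hσ' : σ ∈ Set.Icc 0 T := ⟨hs.1.trans hσ.1.le, hσ.2.trans hτ2.le⟩
    refine (hF σ hσ').trans (le_of_lt (hball ⟨?_, hσ'⟩))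
    rw [Metric.mem_ball, Real.dist_eq, abs_of_pos (sub_pos.2 hσ.1)]
    linarith [hσ.2]
  have hpos : 0 < τ - s := sub_pos.2 hτ.1
  rw [abs_of_pos hpos] at hint
  have htri : ‖x τ - x₀‖ - ‖x s - x₀‖ ≤ ‖x τ - x s‖ := by
    simpa using norm_sub_norm_le (x τ - x₀) (x s - x₀)
  rw [inv_mul_lt_iff₀ hpos]
  nlinarith

/-- A trajectory of the driftless system is a trajectory of the system with drift, for the input
which compensates the drift. -/
theorem reachableSet_driftlessField_subset {a : EuclideanSpace ℝ (Fin m)} {b c R : ℝ}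
    (hT : 0 ≤ T) (hab : ∀ r ∈ Set.Icc 0 R, ‖a‖ ≤ b - c * r) :
    reachableSet (driftlessField a b c x₀) (Metric.closedBall x₀ R) T x₀ ⊆
      reachableSet (driftField a b c x₀) (Metric.closedBall x₀ R) T x₀ := by
  rintro y ⟨v, z, hv, hz, rfl⟩
  have hβ : ∀ t ∈ Set.Icc 0 T, ‖a‖ ≤ b - c * ‖z t - x₀‖ := fun t ht =>
    hab _ ⟨norm_nonneg _, by simpa [dist_eq_norm] using hz.mem_domain t ht⟩
  -- `z` is arbitrary outside `[0, T]`; the cutoff makes the new input measurable on all of `ℝ`.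
  set w : ℝ → EuclideanSpace ℝ (Fin m) := (Set.Icc 0 T).indicator z with hw
  have hwz : ∀ t ∈ Set.Icc 0 T, w t = z t := fun t ht => Set.indicator_of_mem ht z
  have hwm : Measurable w := by
    classical
    rw [hw, ← Set.piecewise_eq_indicator]
    exact hz.continuousOn.measurable_piecewise continuousOn_const measurableSet_Icc
  set u : ℝ → EuclideanSpace ℝ (Fin m) := fun t =>
    (b - c * ‖w t - x₀‖)⁻¹ • ((b - c * ‖w t - x₀‖ - ‖a‖) • v t - a) with hu
  have hfield : ∀ t ∈ Set.Icc 0 T,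
      driftField a b c x₀ (z t) (u t) = driftlessField a b c x₀ (z t) (v t) := by
    intro t ht
    simp only [hu, hwz t ht, driftField, driftlessField]
    -- Where the coefficient vanishes there is no drift to cancel, and both fields are zero.
    rcases eq_or_ne (b - c * ‖z t - x₀‖) 0 with h | h
    · have ha : a = 0 := norm_le_zero_iff.1 (h ▸ hβ t ht)
      simp [h, ha]
    · rw [smul_inv_smul₀ h]
      abel
  refine ⟨u, z, ⟨?_, fun t ht => ?_⟩, ⟨hz.continuousOn, hz.mem_domain, ?_, fun t ht => ?_⟩, rfl⟩
  · have hβm : Measurable fun t => b - c * ‖w t - x₀‖ :=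
      measurable_const.sub ((hwm.sub_const x₀).norm.const_mul c)
    exact hβm.inv.smul (((hβm.sub_const _).smul hv.measurable).sub_const a)
  · simp only [hu, hwz t ht]
    have h := hβ t ht
    have hβ0 : 0 ≤ b - c * ‖z t - x₀‖ := (norm_nonneg a).trans h
    rw [norm_smul, norm_inv, Real.norm_of_nonneg hβ0]
    refine inv_mul_le_one_of_le₀ ?_ hβ0
    calc ‖(b - c * ‖z t - x₀‖ - ‖a‖) • v t - a‖
        ≤ ‖(b - c * ‖z t - x₀‖ - ‖a‖) • v t‖ + ‖a‖ := norm_sub_le _ _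
      _ = (b - c * ‖z t - x₀‖ - ‖a‖) * ‖v t‖ + ‖a‖ := by
          rw [norm_smul, Real.norm_of_nonneg (sub_nonneg.2 h)]
      _ ≤ (b - c * ‖z t - x₀‖ - ‖a‖) * 1 + ‖a‖ := by
          gcongr
          exact hv.norm_le_one t ht
      _ = b - c * ‖z t - x₀‖ := by ring
  · refine IntervalIntegrable.congr (fun t ht => ?_) hz.intervalIntegrable
    rw [Set.uIoc_of_le hT] at ht
    exact (hfield t (Set.Ioc_subset_Icc_self ht)).symm
  · rw [hz.eq_integral t ht]
    congr 1
    refine intervalIntegral.integral_congr fun s hs => ?_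
    rw [Set.uIcc_of_le ht.1] at hs
    exact (hfield s ⟨hs.1, hs.2.trans ht.2⟩).symm

/-- The reachable set of the driftless system is the ball whose radius is the solution of
`r' = b - ‖a‖ - c r`, `r 0 = 0`, at time `T`, truncated at `R`. -/
theorem reachableSet_driftlessField_eq_closedBall {a : EuclideanSpace ℝ (Fin m)} {b c R : ℝ}
    (hR : 0 ≤ R) (hT : 0 ≤ T) (hab : ∀ r ∈ Set.Icc 0 R, ‖a‖ ≤ b - c * r) :
    reachableSet (driftlessField a b c x₀) (Metric.closedBall x₀ R) T x₀ =
      Metric.closedBall x₀ (min R (gronwallBound 0 (-c) (b - ‖a‖) T)) := by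
  have hd : 0 ≤ b - ‖a‖ := by simpa using hab 0 ⟨le_rfl, hR⟩
  ext y
  rw [Metric.mem_closedBall, dist_eq_norm, le_min_iff]
  constructor
  · rintro ⟨u, z, hu, hz, rfl⟩
    have hTT : T ∈ Set.Icc 0 T := ⟨hT, le_rfl⟩
    have hball : ∀ t ∈ Set.Icc 0 T, ‖z t - x₀‖ ≤ R := fun t ht => by
      simpa [dist_eq_norm] using hz.mem_domain t ht
    refine ⟨hball T hTT, hz.norm_sub_le_gronwallBound (fun t ht => ?_) hTT⟩
    have hg : 0 ≤ b - c * ‖z t - x₀‖ - ‖a‖ :=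
      sub_nonneg.2 (hab _ ⟨norm_nonneg _, hball t ht⟩)
    rw [driftlessField, norm_smul, Real.norm_of_nonneg hg]
    nlinarith [mul_le_mul_of_nonneg_left (hu.norm_le_one t ht) hg]
  · rintro ⟨hyR, hyT⟩
    set B := gronwallBound 0 (-c) (b - ‖a‖) with hB
    have hBc : Continuous B := continuous_gronwallBound _ _ _
    have hBm : Monotone B := monotone_gronwallBound_zero hd _
    -- The field is linear in the input, so scaling the input by `k` amounts to replacing `t` by `k
    -- * t`.
    obtain ⟨k, hk, hky⟩ : ‖y - x₀‖ ∈ (fun k => B (k * T)) '' Set.Icc 0 1 := by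
      refine intermediate_value_Icc zero_le_one
        (hBc.comp (continuous_id.mul continuous_const)).continuousOn ⟨?_, ?_⟩
      · simp [hB, gronwallBound_x0]
      · simpa using hyT
    simp only at hky
    -- For `y = x₀` this is `0` because `0⁻¹ = 0`, hence only `‖e‖ ≤ 1` in general.
    set e := ‖y - x₀‖⁻¹ • (y - x₀) with he
    have he1 : ‖e‖ ≤ 1 := by
      rw [he, norm_smul, norm_inv, norm_norm]
      exact inv_mul_le_one
    have hye : ‖y - x₀‖ • e = y - x₀ := by
      rcases eq_or_ne (y - x₀) 0 with h | h
      · simp [h]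
      · rw [he, smul_inv_smul₀ (norm_ne_zero_iff.2 h)]
    set z : ℝ → EuclideanSpace ℝ (Fin m) := fun t => x₀ + B (k * t) • e with hz
    have hzc : Continuous z := by fun_prop
    have hfield : ∀ t, 0 ≤ t → driftlessField a b c x₀ (z t) (k • e) =
        ((-c * B (k * t) + (b - ‖a‖)) * k) • e := by
      intro t ht
      have hBt : 0 ≤ B (k * t) := gronwallBound_zero_nonneg hd _ (mul_nonneg hk.1 ht)
      rcases eq_or_ne (y - x₀) 0 with h | h
      · have : e = 0 := by simp [he, h]
        simp [this, driftlessField]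
      · have hen : ‖e‖ = 1 := by
          rw [he, norm_smul, norm_inv, norm_norm, inv_mul_cancel₀ (norm_ne_zero_iff.2 h)]
        simp only [driftlessField, hz, add_sub_cancel_left, norm_smul, hen,
          Real.norm_of_nonneg hBt, smul_smul]
        congr 1
        ring
    have hderiv : ∀ t, HasDerivAt z (((-c * B (k * t) + (b - ‖a‖)) * k) • e) t := by
      intro t
      have h1 : HasDerivAt (fun t : ℝ => k * t) k t := by
        simpa using (hasDerivAt_id t).const_mul k
      exact (((hasDerivAt_gronwallBound 0 (-c) (b - ‖a‖) (k * t)).comp t h1).smul_const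
        e).const_add x₀
    have hFc : Continuous fun t => driftlessField a b c x₀ (z t) (k • e) := by
      unfold driftlessField
      fun_prop
    refine ⟨fun _ => k • e, z, ⟨measurable_const, fun t _ => ?_⟩,
      ⟨hzc.continuousOn, fun t ht => ?_, hFc.intervalIntegrable _ _, fun t ht => ?_⟩, ?_⟩
    · rw [norm_smul, Real.norm_of_nonneg hk.1]
      exact mul_le_one₀ hk.2 (norm_nonneg _) he1
    · have hBt : 0 ≤ B (k * t) := gronwallBound_zero_nonneg hd _ (mul_nonneg hk.1 ht.1)
      rw [Metric.mem_closedBall, dist_eq_norm, hz, add_sub_cancel_left, norm_smul,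
        Real.norm_of_nonneg hBt]
      calc B (k * t) * ‖e‖ ≤ B (k * t) := mul_le_of_le_one_right hBt he1
        _ ≤ B (k * T) := hBm (mul_le_mul_of_nonneg_left ht.2 hk.1)
        _ ≤ R := hky.trans_le hyR
    · rw [intervalIntegral.integral_eq_sub_of_hasDerivAt (f := z) (fun s hs => ?_)
        (hFc.intervalIntegrable _ _)]
      · simp [hz, hB, gronwallBound_x0]
      · rw [Set.uIcc_of_le ht.1] at hs
        rw [hfield s hs.1]
        exact hderiv s
    · simp [hz, hky, hye]

end Trajectories

theorem mainTheorem2 (m : ℕ) (a x₀ : EuclideanSpace ℝ (Fin m)) (b c R T : ℝ)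
    (hR : 0 < R) (hT : 0 ≤ T) (hab : ∀ r ∈ Set.Icc 0 R, ‖a‖ ≤ b - c * r) :
    reachableSet (driftlessField a b c x₀) (Metric.closedBall x₀ R) T x₀ ⊆
        reachableSet (driftField a b c x₀) (Metric.closedBall x₀ R) T x₀ ∧
      ∃ ρ : ℝ, 0 ≤ ρ ∧ ρ ≤ R ∧
        reachableSet (driftlessField a b c x₀) (Metric.closedBall x₀ R) T x₀ =
          Metric.closedBall x₀ ρ := by
  have hd : 0 ≤ b - ‖a‖ := by simpa using hab 0 ⟨le_rfl, hR.le⟩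
  exact ⟨reachableSet_driftlessField_subset hT hab, min R (gronwallBound 0 (-c) (b - ‖a‖) T),
    le_min hR.le (gronwallBound_zero_nonneg hd _ hT), min_le_left _ _,
    reachableSet_driftlessField_eq_closedBall hR.le hT hab⟩
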